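/- All graphs are finite and simple. The connectivity $\kappa(G)$ of a graph $G$ is the minimum number of vertices whose removal results in a disconnected graph or in a trivial graph (one with at most one vertex). A graph $G$ is minimally $2$-connected if $\kappa(G)\ge 2$ but $\kappa(G-e)<2$ for every edge $e$ of $G$. The spectral radius $\rho(G)$ is the largest eigenvalue of the adjacency matrix of $G$. For $n\ge 1$, let $SK_{2,n}$ denote the graph obtained from the complete bipartite graph $K_{2,n}$ by subdividing one edge once (the result does not depend on the edge, up to isomorphism). **Theorem 1.1.** Let $G$ be a minimally $2$-connected graph with $m$ edges. (i) If $m$ is even, then $\rho(G)\le\sqrt{m}$, and equality holds if and only if $G\cong K_{2,m/2}$. (ii) If $m$ is odd and $m\ge 9$, then $\rho(G)\le\rho_1^*(m)$, where $\rho_1^*(m)$ is the largest real root of $x^3-x^2-(m-2)x+m-3=0$, and equality holds if and only if $G\cong SK_{2,(m-1)/2}$. -/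

import Mathlib

namespace SimpleGraph

/-- Removing the vertices of `S` from `G` leaves a disconnected graph or a trivial one
(at most one vertex). -/
def IsVertexCut {V : Type*} (G : SimpleGraph V) (S : Finset V) : Prop :=
  ¬ (G.induce {v | v ∉ S}).Preconnected ∨ {v | v ∉ S}.Subsingleton

/-- The vertex-connectivity `κ(G)` of a finite graph: the minimum number of vertices whose removal
results in a disconnected graph or in a trivial graph. -/
noncomputable def vertexConnectivity {V : Type*} [Fintype V] (G : SimpleGraph V) : ℕ :=
  sInf {k | ∃ S : Finset V, S.card = k ∧ G.IsVertexCut S}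

/-- `G` is `k`-connected: its vertex-connectivity is at least `k`. -/
def IsKConnected {V : Type*} [Fintype V] (k : ℕ) (G : SimpleGraph V) : Prop :=
  k ≤ G.vertexConnectivity

/-- `G` is `k`-connected iff no vertex set with fewer than `k` elements is a cut. -/
theorem isKConnected_iff {V : Type*} [Fintype V] (k : ℕ) (G : SimpleGraph V) :
    G.IsKConnected k ↔ ∀ S : Finset V, G.IsVertexCut S → k ≤ S.card := by
  have hne : {k | ∃ S : Finset V, S.card = k ∧ G.IsVertexCut S}.Nonempty :=
    ⟨_, Finset.univ, rfl, Or.inr fun x hx => absurd (Finset.mem_univ x) hx⟩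
  constructor
  · intro h S hS
    exact le_trans h (Nat.sInf_le ⟨S, rfl, hS⟩)
  · intro h
    obtain ⟨S, hc, hS⟩ := Nat.sInf_mem hne
    exact le_of_le_of_eq (h S hS) hc

/-- `G` is minimally `k`-connected: it is `k`-connected, and omitting any edge gives a graph that is
not `k`-connected. -/
def IsMinimallyKConnected {V : Type*} [Fintype V] (k : ℕ) (G : SimpleGraph V) : Prop :=
  G.IsKConnected k ∧ ∀ e ∈ G.edgeSet, ¬ (G.deleteEdges {e}).IsKConnected k

/-- The spectral radius `ρ(G)`: the largest (real) eigenvalue of the adjacency matrix of `G`. -/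
noncomputable def rho {V : Type*} [Fintype V] [DecidableEq V] (G : SimpleGraph V)
    [DecidableRel G.Adj] : ℝ :=
  sSup {μ : ℝ | Module.End.HasEigenvalue (Matrix.toLin' (G.adjMatrix ℝ)) μ}

/-- The supremum defining `ρ(G)` is attained: it is the largest eigenvalue. -/
theorem isGreatest_rho {V : Type*} [Fintype V] [DecidableEq V] [Nonempty V] (G : SimpleGraph V)
    [DecidableRel G.Adj] :
    IsGreatest {μ : ℝ | Module.End.HasEigenvalue (Matrix.toLin' (G.adjMatrix ℝ)) μ} G.rho := by
  have hA : (G.adjMatrix ℝ).IsHermitian := by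
    rw [Matrix.IsHermitian, Matrix.conjTranspose_eq_transpose_of_trivial]
    exact G.isSymm_adjMatrix
  have hs : {μ : ℝ | Module.End.HasEigenvalue (Matrix.toLin' (G.adjMatrix ℝ)) μ}
      = Set.range hA.eigenvalues := by
    rw [← hA.spectrum_real_eq_range_eigenvalues, ← Matrix.spectrum_toLin']
    ext μ
    exact Module.End.hasEigenvalue_iff_mem_spectrum
  have hf : {μ : ℝ | Module.End.HasEigenvalue (Matrix.toLin' (G.adjMatrix ℝ)) μ}.Finite := by
    rw [hs]; exact Set.finite_range _
  have hn : {μ : ℝ | Module.End.HasEigenvalue (Matrix.toLin' (G.adjMatrix ℝ)) μ}.Nonempty := by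
    rw [hs]; exact Set.range_nonempty _
  exact ⟨hn.csSup_mem hf, fun μ hμ => le_csSup hf.bddAbove hμ⟩

/-- The graph obtained from `G` by subdividing `e` once (meant for an edge `e` of `G`): `e` is
deleted, and a new vertex `none` is joined to the two ends of `e`. -/
def subdivideEdge {V : Type*} (G : SimpleGraph V) (e : Sym2 V) : SimpleGraph (Option V) where
  Adj
    | some a, some b => (G.deleteEdges {e}).Adj a b
    | some a, none => a ∈ e
    | none, some b => b ∈ e
    | none, none => False
  symm := ⟨by
    rintro (_ | a) (_ | b) h
    · exact h
    · exact h
    · exact h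
    · exact (G.deleteEdges {e}).symm.symm _ _ h⟩
  loopless := ⟨by
    rintro (_ | a) h
    · exact h
    · exact (G.deleteEdges {e}).loopless.irrefl a h⟩

end SimpleGraph

/-!
A minimally 2-connected graph has no cycle with a chord. Hence it is triangle-free unless it is a
triangle. Scale a Perron vector `y` so that its largest entry is `1`, at a vertex `u`. Evaluating
`A ^ 2 y = ρ ^ 2 y` at `u` and counting the edges by their ends in `N(u)` gives
`m = ρ ^ 2 + e(V ∖ N(u)) + ∑ w ∉ N[u], |N(u) ∩ N(w)| * (1 - y w)`.
Thus `ρ ^ 2 ≤ m`, with equality only if every edge meets `N(u)`, and then the absence of chords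
forces `G ≅ K_{2,n}`, so that `m = 2n`.

The cubic equation is `(x - 1) * (x ^ 2 - (m - 2)) = 1`. If `m` is odd and `ρ` is at least its
largest root, then `ρ ^ 2 > m - 2` and parity leave exactly one edge `ab` outside `N(u)`. The
eigenvalue equations at `a` and `b` turn the identity above into
`(ρ - 1) * (ρ ^ 2 - (m - 2)) = 1 - (nonnegative terms)`, so that all these terms vanish. This gives
`V ∖ N[u] = {a, b}` and `N(u) = N(u) ∩ N(a) ∪ N(u) ∩ N(b)` with one of these two parts a
singleton, which is the structure of `SK_{2,n}`.
-/

section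

open Finset SimpleGraph

section Connectivity

variable {V : Type*} [Fintype V] {G : SimpleGraph V} {k : ℕ}

theorem exists_isPath_disjoint_of_isKConnected (hG : G.IsKConnected k) {S : Finset V}
    (hS : #S < k) {a b : V} (ha : a ∉ S) (hb : b ∉ S) :
    ∃ p : G.Walk a b, p.IsPath ∧ ∀ v ∈ p.support, v ∉ S := by
  have hpre : (G.induce {v | v ∉ S}).Preconnected := by
    by_contra h
    exact hS.not_ge ((isKConnected_iff k G).1 hG S (Or.inl h))
  obtain ⟨p, hp⟩ := (hpre ⟨a, ha⟩ ⟨b, hb⟩).exists_isPath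
  refine ⟨p.map (Embedding.induce _).toHom, hp.map Subtype.val_injective, fun v hv => ?_⟩
  obtain ⟨w, -, rfl⟩ := List.mem_map.1 (p.support_map _ ▸ hv)
  exact w.2

theorem exists_boundary_adj_of_isKConnected (hG : G.IsKConnected k) {S : Finset V} (hS : #S < k)
    {A : Set V} {a b : V} (ha : a ∈ A) (haS : a ∉ S) (hb : b ∉ A) (hbS : b ∉ S) :
    ∃ p ∈ A, ∃ q ∉ A, p ∉ S ∧ q ∉ S ∧ G.Adj p q := by
  obtain ⟨w, -, hw⟩ := exists_isPath_disjoint_of_isKConnected hG hS haS hbS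
  obtain ⟨d, hd, hdA, hdA'⟩ := w.exists_boundary_dart A ha hb
  exact ⟨d.fst, hdA, d.snd, hdA', hw _ (w.dart_fst_mem_support_of_mem_darts hd),
    hw _ (w.dart_snd_mem_support_of_mem_darts hd), d.adj⟩

theorem lt_card_of_isKConnected (hk : 0 < k) (hG : G.IsKConnected k) : k < Fintype.card V := by
  classical
  rw [isKConnected_iff] at hG
  rcases isEmpty_or_nonempty V with hV | ⟨⟨x⟩⟩
  · exact absurd (hG ∅ (Or.inr fun a => hV.elim a)) (by simpa using hk.ne')
  · have h := hG (univ.erase x) (Or.inr fun a ha b hb => by simp_all)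
    rw [card_erase_of_mem (mem_univ x), card_univ] at h
    lia

theorem le_degree_of_isKConnected [DecidableRel G.Adj] (hG : G.IsKConnected k) (v : V) :
    k ≤ G.degree v := by
  classical
  by_contra! hlt
  have hcard : #(insert v (G.neighborFinset v)) < #(univ : Finset V) := by
    have := lt_card_of_isKConnected (by lia) hG
    have := card_insert_le v (G.neighborFinset v)
    rw [card_neighborFinset_eq_degree] at this
    rw [card_univ]
    lia
  obtain ⟨z, -, hz⟩ := exists_mem_notMem_of_card_lt_card hcard
  rw [mem_insert, not_or] at hz
  obtain ⟨p, rfl, q, -, -, hq, hpq⟩ := exists_boundary_adj_of_isKConnected hG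
    (S := G.neighborFinset v) hlt (Set.mem_singleton v) (G.notMem_neighborFinset_self v) hz.1 hz.2
  exact hq ((G.mem_neighborFinset p q).2 hpq)

theorem exists_adj_ne_of_isKConnected (hk : 2 ≤ k) (hG : G.IsKConnected k) (v x : V) :
    ∃ w, G.Adj v w ∧ w ≠ x := by
  classical
  have hdeg : 1 < #(G.neighborFinset v) := hk.trans (le_degree_of_isKConnected hG v)
  simpa using exists_mem_ne hdeg x

theorem card_le_card_edgeFinset_of_isKConnected [DecidableRel G.Adj] (hk : 2 ≤ k)
    (hG : G.IsKConnected k) : Fintype.card V ≤ #G.edgeFinset := by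
  have h : ∑ _v : V, 2 ≤ ∑ v, G.degree v :=
    sum_le_sum fun v _ => hk.trans (le_degree_of_isKConnected hG v)
  rw [sum_degrees_eq_twice_card_edges, sum_const, card_univ, smul_eq_mul] at h
  lia

theorem exists_bridging_cut (hG : G.IsMinimallyKConnected k) {x y : V} (hxy : G.Adj x y) :
    ∃ S : Finset V, #S < k ∧ x ∉ S ∧ y ∉ S ∧ ∃ A : Set V, x ∈ A ∧ y ∉ A ∧
      ∀ p ∈ A, ∀ q ∉ A, p ∉ S → q ∉ S → G.Adj p q → s(p, q) = s(x, y) := by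
  classical
  obtain ⟨hconn, hmin⟩ := hG
  have hdel := hmin s(x, y) hxy
  rw [isKConnected_iff] at hdel
  push Not at hdel
  obtain ⟨S, hcut, hS⟩ := hdel
  have hnot_pre := hcut.resolve_right fun h =>
    hS.not_ge ((isKConnected_iff k G).1 hconn S (Or.inr h))
  unfold Preconnected at hnot_pre
  push Not at hnot_pre
  obtain ⟨⟨a, ha⟩, ⟨b, hb⟩, hab⟩ := hnot_pre
  let A : Set V := {z | ∃ hz : z ∉ S,
    ((G.deleteEdges {s(x, y)}).induce {v | v ∉ S}).Reachable ⟨a, ha⟩ ⟨z, hz⟩}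
  have hcross : ∀ p ∈ A, ∀ q ∉ A, p ∉ S → q ∉ S → G.Adj p q → s(p, q) = s(x, y) := by
    rintro p ⟨hp, hap⟩ q hq - hqS hpq
    by_contra hne
    refine hq ⟨hqS, hap.trans (Adj.reachable ?_)⟩
    simpa only [comap_adj, deleteEdges_adj, Function.Embedding.subtype_apply,
      Set.mem_singleton_iff] using ⟨hpq, hne⟩
  obtain ⟨p, hp, q, hq, hpS, hqS, hpq⟩ := exists_boundary_adj_of_isKConnected hconn hS
    (A := A) ⟨ha, Reachable.refl _⟩ ha (fun ⟨_, h⟩ => hab h) hb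
  rcases Sym2.eq_iff.1 (hcross p hp q hq hpS hqS hpq) with ⟨rfl, rfl⟩ | ⟨rfl, rfl⟩
  · exact ⟨S, hS, hpS, hqS, A, hp, hq, hcross⟩
  · refine ⟨S, hS, hqS, hpS, Aᶜ, hq, fun h => h hp, fun v hv w hw hvS hwS hvw => ?_⟩
    rw [Sym2.eq_swap]
    exact hcross w (not_not.1 hw) v hv hwS hvS hvw.symm

theorem mem_edges_of_disjoint_walks (hG : G.IsMinimallyKConnected 2) {x y : V} (hxy : G.Adj x y)
    (p q : G.Walk x y) (hpq : ∀ v ∈ p.support, v ∈ q.support → v = x ∨ v = y) :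
    s(x, y) ∈ p.edges ∨ s(x, y) ∈ q.edges := by
  obtain ⟨S, hS, hxS, hyS, A, hxA, hyA, hcross⟩ := exists_bridging_cut hG hxy
  have hmem (w : G.Walk x y) (hw : ∀ v ∈ w.support, v ∉ S) : s(x, y) ∈ w.edges := by
    obtain ⟨d, hd, hdA, hdA'⟩ := w.exists_boundary_dart A hxA hyA
    rw [← hcross d.fst hdA d.snd hdA' (hw _ (w.dart_fst_mem_support_of_mem_darts hd))
      (hw _ (w.dart_snd_mem_support_of_mem_darts hd)) d.adj]
    exact List.mem_map_of_mem hd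
  by_contra! h
  obtain ⟨v, hvp, hvS⟩ : ∃ v ∈ p.support, v ∈ S := by
    by_contra! hp
    exact h.1 (hmem p hp)
  obtain ⟨w, hwq, hwS⟩ : ∃ w ∈ q.support, w ∈ S := by
    by_contra! hq
    exact h.2 (hmem q hq)
  obtain rfl := card_le_one.1 (Nat.le_of_lt_succ hS) v hvS w hwS
  rcases hpq v hvp hwq with rfl | rfl
  · exact hxS hvS
  · exact hyS hvS

end Connectivity

section TriangleFree

variable {V : Type*} {G : SimpleGraph V}

theorem not_adj_of_cliqueFree_three (hT : G.CliqueFree 3) {v a b : V} (ha : G.Adj v a)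
    (hb : G.Adj v b) : ¬ G.Adj a b :=
  fun h => G.isIndepSet_neighborSet_of_triangleFree hT v ha hb h.ne h

variable [Fintype V]

theorem eq_or_eq_of_adj_of_triangle (hG : G.IsMinimallyKConnected 2) {x y z t : V}
    (hxy : G.Adj x y) (hxz : G.Adj x z) (hyz : G.Adj y z) (hxt : G.Adj x t) :
    t = y ∨ t = z := by
  classical
  by_contra! ht
  have hmeet {y z : V} (hxy : G.Adj x y) (hxz : G.Adj x z) (hyz : G.Adj y z) (hty : t ≠ y)
      (p : G.Walk t y) (hp : x ∉ p.support) : z ∈ p.support := by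
    by_contra hz
    have hdisj : ∀ v ∈ (Walk.cons hxz (Walk.cons hyz.symm Walk.nil)).support,
        v ∈ (Walk.cons hxt p).support → v = x ∨ v = y := by
      simp only [Walk.support_cons, Walk.support_nil, List.mem_cons, List.not_mem_nil, or_false]
      rintro v (rfl | rfl | rfl) (h | h) <;> tauto
    rcases mem_edges_of_disjoint_walks hG hxy _ _ hdisj with h | h
    · simp [hxy.ne, hxz.ne, hyz.ne] at h
    · rw [Walk.edges_cons, List.mem_cons] at h
      rcases h with h | h
      · exact hty (Sym2.congr_right.1 h).symm
      · exact hp (p.fst_mem_support_of_mem_edges h)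
  obtain ⟨p, hp, hxp⟩ := exists_isPath_disjoint_of_isKConnected hG.1 (S := {x}) (by simp)
    (a := t) (b := y) (by simpa using hxt.ne') (by simpa using hxy.ne')
  have hxp : x ∉ p.support := fun h => hxp x h (mem_singleton_self x)
  have hzp := hmeet hxy hxz hyz ht.1 p hxp
  have hxp' : x ∉ (p.takeUntil z hzp).support :=
    fun h => hxp (p.support_takeUntil_subset_support hzp h)
  exact Walk.endpoint_notMem_support_takeUntil hp hzp hyz.ne (hmeet hxz hxy hyz.symm ht.2 _ hxp')

theorem cliqueFree_three_of_isMinimallyKConnected [DecidableRel G.Adj]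
    (hG : G.IsMinimallyKConnected 2) (h3 : #G.edgeFinset ≠ 3) : G.CliqueFree 3 := by
  classical
  intro s hs
  obtain ⟨x, y, z, hxy, hxz, hyz, rfl⟩ := is3Clique_iff.1 hs
  have huniv : ({x, y, z} : Finset V) = univ := by
    by_contra h
    obtain ⟨t, ht⟩ : ∃ t, t ∉ ({x, y, z} : Finset V) := by
      by_contra! h'
      exact h (eq_univ_of_forall h')
    obtain ⟨p, hp, q, hq, -, -, hpq⟩ := exists_boundary_adj_of_isKConnected hG.1 (S := ∅)
      (by simp) (A := ({x, y, z} : Finset V)) (by simp : x ∈ _) (by simp) ht (by simp)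
    simp only [mem_coe, mem_insert, mem_singleton, not_or] at hp hq
    rcases hp with rfl | rfl | rfl
    · have := eq_or_eq_of_adj_of_triangle hG hxy hxz hyz hpq
      tauto
    · have := eq_or_eq_of_adj_of_triangle hG hxy.symm hyz hxz hpq
      tauto
    · have := eq_or_eq_of_adj_of_triangle hG hxz.symm hyz.symm hxy hpq
      tauto
  have hcard : Fintype.card V = 3 := by rw [← card_univ, ← huniv, hs.card_eq]
  have hle : #G.edgeFinset ≤ 3 := by simpa [hcard] using G.card_edgeFinset_le_card_choose_two
  have hge := card_le_card_edgeFinset_of_isKConnected le_rfl hG.1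
  lia

end TriangleFree

section Recognition

variable {V : Type*}

theorem exists_equiv_completeBipartiteGraph_adj_iff [Fintype V] (p : V → Prop) [DecidablePred p]
    {m n : ℕ} (hm : #{v | p v} = m) (hn : #{v | ¬ p v} = n) :
    ∃ φ : V ≃ Fin m ⊕ Fin n,
      ∀ v w, (completeBipartiteGraph (Fin m) (Fin n)).Adj (φ v) (φ w) ↔ ¬ (p v ↔ p w) := by
  let e₁ := Fintype.equivFinOfCardEq ((Fintype.card_subtype p).trans hm)
  let e₂ := Fintype.equivFinOfCardEq ((Fintype.card_subtype (¬ p ·)).trans hn)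
  refine ⟨(Equiv.sumCompl p).symm.trans (e₁.sumCongr e₂), fun v w => ?_⟩
  by_cases hv : p v <;> by_cases hw : p w <;> simp [hv, hw]

theorem nonempty_iso_subdivideEdge {W : Type*} {G : SimpleGraph V} {H : SimpleGraph W}
    {e : Sym2 W} {b : V} (φ : {v // v ≠ b} ≃ W)
    (hφ : ∀ v w : {v // v ≠ b}, G.Adj v w ↔ (H.deleteEdges {e}).Adj (φ v) (φ w))
    (hb : ∀ v : {v // v ≠ b}, G.Adj b v ↔ φ v ∈ e) : Nonempty (G ≃g H.subdivideEdge e) := by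
  classical
  let ψ : Option W ≃ V := (Equiv.optionCongr φ.symm).trans (Equiv.optionSubtypeNe b)
  have hnone : ψ none = b := rfl
  have hsome (w : W) : ψ (some w) = φ.symm w := rfl
  refine ⟨Iso.symm ⟨ψ, ?_⟩⟩
  rintro (_ | v) (_ | w)
  · simp [subdivideEdge]
  · simp [subdivideEdge, hnone, hsome, hb]
  · simp [subdivideEdge, hnone, hsome, G.adj_comm _ b, hb]
  · simp [subdivideEdge, hsome, hφ]

variable {G : SimpleGraph V}

theorem exists_iso_completeBipartiteGraph_two [Finite V] {s t : V} (hst : s ≠ t)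
    (hadj : ¬ G.Adj s t) (h : ∀ z, z ≠ s → z ≠ t → ∀ x, G.Adj z x ↔ x = s ∨ x = t) :
    ∃ n, Nonempty (G ≃g completeBipartiteGraph (Fin 2) (Fin n)) := by
  classical
  cases nonempty_fintype V
  obtain ⟨φ, hφ⟩ := exists_equiv_completeBipartiteGraph_adj_iff (fun v => v = s ∨ v = t)
    (card_eq_two.2 ⟨s, t, hst, by ext; simp⟩) rfl
  refine ⟨_, ⟨⟨φ, fun {v w} => ?_⟩⟩⟩
  rw [hφ]
  by_cases hv : v = s ∨ v = t
  · by_cases hw : w = s ∨ w = t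
    · rcases hv with rfl | rfl <;> rcases hw with rfl | rfl <;> simp_all [G.adj_comm]
    · rw [G.adj_comm, h w (by tauto) (by tauto)]
      tauto
  · rw [h v (by tauto) (by tauto)]
    tauto

theorem adj_iff_of_two_nonneighbors {u a q v w : V} (hau : a ≠ u) (hua : ¬ G.Adj u a)
    (hind : ∀ v w, G.Adj u v → G.Adj u w → ¬ G.Adj v w) (huq : G.Adj u q)
    (ha : ∀ v, G.Adj u v → (G.Adj a v ↔ v ≠ q)) (hv : G.Adj u v ∨ v = u ∨ v = a)
    (hw : G.Adj u w ∨ w = u ∨ w = a) :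
    G.Adj v w ↔ ¬ (¬ G.Adj u v ↔ ¬ G.Adj u w) ∧ s(v, w) ≠ s(a, q) := by
  have hcross {x y : V} (hx : x = u ∨ x = a) (hy : G.Adj u y) :
      G.Adj x y ↔ s(x, y) ≠ s(a, q) := by
    rcases hx with rfl | rfl
    · simp [hy, hau.symm, huq.ne]
    · have hxq : x ≠ q := fun h => hua (h ▸ huq)
      simp [ha y hy, hxq]
  have hnot {x : V} (hx : x = u ∨ x = a) : ¬ G.Adj u x := by
    rcases hx with rfl | rfl
    exacts [G.irrefl, hua]
  rcases hv with huv | hv <;> rcases hw with huw | hw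
  · simp [huv, huw, hind v w huv huw]
  · rw [G.adj_comm, hcross hw huv, Sym2.eq_swap]
    have := hnot hw
    tauto
  · rw [hcross hv huw]
    have := hnot hv
    tauto
  · have hvw : ¬ G.Adj v w := by
      rcases hv with rfl | rfl
      · exact hnot hw
      · rcases hw with rfl | rfl
        exacts [fun h => hua h.symm, G.irrefl]
    simp [hnot hv, hnot hw, hvw]

theorem exists_iso_subdivideEdge [Fintype V] [DecidableRel G.Adj] {u a b q : V}
    (hau : a ≠ u) (hbu : b ≠ u) (hab : a ≠ b) (hua : ¬ G.Adj u a) (hub : ¬ G.Adj u b)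
    (hW : ∀ w, ¬ G.Adj u w → w = u ∨ w = a ∨ w = b)
    (hind : ∀ v w, G.Adj u v → G.Adj u w → ¬ G.Adj v w) (huq : G.Adj u q)
    (hb : ∀ v, G.Adj b v ↔ v = a ∨ v = q) (ha : ∀ v, G.Adj u v → (G.Adj a v ↔ v ≠ q)) :
    ∃ e ∈ (completeBipartiteGraph (Fin 2) (Fin (G.degree u))).edgeSet,
      Nonempty (G ≃g (completeBipartiteGraph (Fin 2) (Fin (G.degree u))).subdivideEdge e) := by
  classical
  have hm : #{v : {v // v ≠ b} | ¬ G.Adj u v} = 2 := by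
    rw [card_eq_two]
    refine ⟨⟨u, hbu.symm⟩, ⟨a, hab⟩, by simpa using hau.symm, ?_⟩
    ext ⟨v, hv⟩
    simp only [mem_filter, mem_univ, true_and, mem_insert, mem_singleton, Subtype.mk.injEq]
    refine ⟨fun h => by have := hW v h; tauto, ?_⟩
    rintro (rfl | rfl)
    · exact G.irrefl
    · exact hua
  have hn : #{v : {v // v ≠ b} | ¬ ¬ G.Adj u v} = G.degree u := by
    rw [← card_neighborFinset_eq_degree, ← card_map (Function.Embedding.subtype _)]
    congr 1
    ext v
    simpa using fun (h : G.Adj u v) (hvb : v = b) => hub (hvb ▸ h)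
  obtain ⟨φ, hφ⟩ := exists_equiv_completeBipartiteGraph_adj_iff
    (fun v : {v // v ≠ b} => ¬ G.Adj u v) hm hn
  have hqb : q ≠ b := fun h => hub (h ▸ huq)
  refine ⟨s(φ ⟨a, hab⟩, φ ⟨q, hqb⟩), by simp [-completeBipartiteGraph_adj, hφ, hua, huq],
    nonempty_iso_subdivideEdge φ (fun ⟨v, hv⟩ ⟨w, hw⟩ => ?_) fun ⟨v, hv⟩ => by simp [hb]⟩
  rw [deleteEdges_adj, Set.mem_singleton_iff, hφ]
  have hinj : s(φ ⟨v, hv⟩, φ ⟨w, hw⟩) = s(φ ⟨a, hab⟩, φ ⟨q, hqb⟩) ↔ s(v, w) = s(a, q) := by simp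
  have hmem (v : V) (hvb : v ≠ b) : G.Adj u v ∨ v = u ∨ v = a := by
    have := hW v
    tauto
  rw [hinj]
  exact adj_iff_of_two_nonneighbors hau hua hind huq ha (hmem v hv) (hmem w hw)

end Recognition

section BipartiteStructure

variable {V : Type*} [Fintype V] {G : SimpleGraph V} {u : V}

theorem eq_of_chorded_hexagon (hG : G.IsMinimallyKConnected 2) {v a b c d : V} (huv : G.Adj u v)
    (hav : G.Adj a v) (hbv : G.Adj b v) (hac : G.Adj a c) (hbd : G.Adj b d) (huc : G.Adj u c)
    (hud : G.Adj u d) (hau : a ≠ u) (hbu : b ≠ u) (hab : a ≠ b) (had : a ≠ d) (hbc : b ≠ c)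
    (hcv : c ≠ v) (hdv : d ≠ v) : c = d := by
  by_contra hcd
  have hdisj : ∀ z ∈ (Walk.cons huc (Walk.cons hac.symm (Walk.cons hav Walk.nil))).support,
      z ∈ (Walk.cons hud (Walk.cons hbd.symm (Walk.cons hbv Walk.nil))).support →
        z = u ∨ z = v := by
    simp only [Walk.support_cons, Walk.support_nil, List.mem_cons, List.not_mem_nil, or_false]
    rintro z (rfl | rfl | rfl | rfl) (h | h | h | h) <;> tauto
  rcases mem_edges_of_disjoint_walks hG huv _ _ hdisj with h | h
  · simp [huv.ne, hcv.symm, hau.symm, huc.ne] at h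
  · simp [huv.ne, hdv.symm, hbu.symm, hud.ne] at h

theorem adj_iff_of_common_neighbor (hG : G.IsMinimallyKConnected 2)
    (hN : ∀ a b, G.Adj a b → G.Adj u a ∨ G.Adj u b) {a b v : V} (hau : a ≠ u)
    (hbu : b ≠ u) (hab : a ≠ b) (hua : ¬ G.Adj u a) (hub : ¬ G.Adj u b) (hav : G.Adj a v)
    (hbv : G.Adj b v) :
    ∃ v', v' ≠ v ∧ (∀ x, G.Adj a x ↔ x = v ∨ x = v') ∧ ∀ x, G.Adj b x ↔ x = v ∨ x = v' := by
  have hab' : ¬ G.Adj a b := fun h => (hN a b h).elim hua hub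
  have heq {x y : V} (hax : G.Adj a x) (hby : G.Adj b y) (hxv : x ≠ v) (hyv : y ≠ v) : x = y :=
    eq_of_chorded_hexagon hG ((hN a v hav).resolve_left hua) hav hbv hax hby
      ((hN a x hax).resolve_left hua) ((hN b y hby).resolve_left hub) hau hbu hab
      (fun h => hab' (h ▸ hby.symm)) (fun h => hab' (h ▸ hax)) hxv hyv
  obtain ⟨x, hax, hxv⟩ := exists_adj_ne_of_isKConnected le_rfl hG.1 a v
  obtain ⟨y, hby, hyv⟩ := exists_adj_ne_of_isKConnected le_rfl hG.1 b v
  obtain rfl := heq hax hby hxv hyv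
  refine ⟨x, hxv, fun z => ⟨fun haz => ?_, ?_⟩, fun z => ⟨fun hbz => ?_, ?_⟩⟩
  · exact or_iff_not_imp_left.2 fun hzv => heq haz hby hzv hyv
  · rintro (rfl | rfl) <;> assumption
  · exact or_iff_not_imp_left.2 fun hzv => (heq hax hbz hxv hzv).symm
  · rintro (rfl | rfl) <;> assumption

theorem exists_adj_common_neighbor (hG : G.IsKConnected 2) (hT : G.CliqueFree 3)
    (hN : ∀ a b, G.Adj a b → G.Adj u a ∨ G.Adj u b) {a c : V} (hau : a ≠ u) (hcu : c ≠ u)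
    (hca : c ≠ a) (hua : ¬ G.Adj u a) (huc : ¬ G.Adj u c) :
    ∃ b v, b ≠ u ∧ b ≠ a ∧ ¬ G.Adj u b ∧ G.Adj a v ∧ G.Adj b v := by
  obtain ⟨v, hv, b, hb, -, hbu, hvb⟩ := exists_boundary_adj_of_isKConnected hG (S := {u})
    (by simp) (A := insert a (G.neighborSet a)) (Set.mem_insert a _) (by simpa using hau)
    (b := c) (by simpa [hca] using fun h => (hN a c h).elim hua huc) (by simpa using hcu)
  simp only [Set.mem_insert_iff, mem_neighborSet, not_or, mem_singleton] at hv hb hbu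
  rcases hv with rfl | hav
  · exact absurd hvb hb.2
  · have huv := (hN a v hav).resolve_left hua
    exact ⟨b, v, hbu, hb.1, fun hub => not_adj_of_cliqueFree_three hT huv hub hvb, hav, hvb.symm⟩

theorem adj_iff_of_twin_neighbors (hG : G.IsMinimallyKConnected 2) (hT : G.CliqueFree 3)
    (hN : ∀ a b, G.Adj a b → G.Adj u a ∨ G.Adj u b) {a v v' : V} (hau : a ≠ u)
    (hua : ¬ G.Adj u a) (ha : ∀ x, G.Adj a x ↔ x = v ∨ x = v') {z : V} (hzu : z ≠ u)
    (hzv : z ≠ v) (hzv' : z ≠ v') (x : V) : G.Adj z x ↔ x = v ∨ x = v' := by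
  let A : Set V := {c | c = v ∨ c = v' ∨ ∀ x, G.Adj c x ↔ x = v ∨ x = v'}
  suffices hz : z ∈ A from (hz.resolve_left hzv).resolve_left hzv' x
  by_contra hz
  obtain ⟨p, hp, q, hq, -, hqu, hpq⟩ := exists_boundary_adj_of_isKConnected hG.1 (S := {u})
    (by simp) (A := A) (a := a) (Or.inr (Or.inr ha)) (by simpa using hau) hz (by simpa using hzu)
  by_cases hap : G.Adj a p
  · have hup := (hN a p hap).resolve_left hua
    have huq : ¬ G.Adj u q := fun huq => not_adj_of_cliqueFree_three hT hup huq hpq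
    have haq : a ≠ q := fun h => hq (h ▸ Or.inr (Or.inr ha))
    obtain ⟨w, -, ha', hq'⟩ := adj_iff_of_common_neighbor hG hN hau (by simpa using hqu) haq hua
      huq hap hpq.symm
    exact hq (Or.inr (Or.inr fun x => (hq' x).trans ((ha' x).symm.trans (ha x))))
  · rw [ha, not_or] at hap
    rcases ((hp.resolve_left hap.1).resolve_left hap.2 q).1 hpq with h | h
    exacts [hq (Or.inl h), hq (Or.inr (Or.inl h))]

theorem adj_iff_of_unique_nonneighbor (hG : G.IsKConnected 2) (hT : G.CliqueFree 3) {a z : V}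
    (ha : ∀ c, c ≠ u → ¬ G.Adj u c → c = a) (hzu : z ≠ u) (hza : z ≠ a) (x : V) :
    G.Adj z x ↔ x = u ∨ x = a := by
  have huz : G.Adj u z := by
    by_contra huz
    exact hza (ha z hzu huz)
  have hx {x : V} (hzx : G.Adj z x) (hxu : x ≠ u) : x = a :=
    ha x hxu fun hux => not_adj_of_cliqueFree_three hT huz hux hzx
  refine ⟨fun hzx => or_iff_not_imp_left.2 (hx hzx), ?_⟩
  rintro (rfl | rfl)
  · exact huz.symm
  · obtain ⟨y, hzy, hyu⟩ := exists_adj_ne_of_isKConnected le_rfl hG z u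
    exact hx hzy hyu ▸ hzy

theorem exists_iso_completeBipartiteGraph_two_of_forall_adj_neighbor
    (hG : G.IsMinimallyKConnected 2) (hT : G.CliqueFree 3)
    (hN : ∀ a b, G.Adj a b → G.Adj u a ∨ G.Adj u b) :
    ∃ n, Nonempty (G ≃g completeBipartiteGraph (Fin 2) (Fin n)) := by
  obtain ⟨v₀, huv₀, -⟩ := exists_adj_ne_of_isKConnected le_rfl hG.1 u u
  obtain ⟨a, hv₀a, hau⟩ := exists_adj_ne_of_isKConnected le_rfl hG.1 v₀ u
  have hua : ¬ G.Adj u a := fun hua => not_adj_of_cliqueFree_three hT huv₀ hua hv₀a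
  by_cases hsingle : ∀ c, c ≠ u → ¬ G.Adj u c → c = a
  · exact exists_iso_completeBipartiteGraph_two hau.symm hua fun _ =>
      adj_iff_of_unique_nonneighbor hG.1 hT hsingle
  · push Not at hsingle
    obtain ⟨c, hcu, huc, hca⟩ := hsingle
    obtain ⟨b, v, hbu, hba, hub, hav, hbv⟩ :=
      exists_adj_common_neighbor hG.1 hT hN hau hcu hca hua huc
    obtain ⟨v', hvv', ha, -⟩ := adj_iff_of_common_neighbor hG hN hau hbu hba.symm hua hub hav hbv
    have htwins {z : V} := adj_iff_of_twin_neighbors hG hT hN hau hua ha (z := z)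
    have hav' := (ha v').2 (Or.inr rfl)
    refine exists_iso_completeBipartiteGraph_two hvv'.symm
      (not_adj_of_cliqueFree_three hT hav hav') fun z hzv hzv' x => ?_
    by_cases hzu : z = u
    · subst hzu
      refine ⟨fun hzx => ?_, fun hx => (hN a x ((ha x).2 hx)).resolve_left hua⟩
      by_contra! hx
      have := (htwins hzx.ne' hx.1 hx.2 z).1 hzx.symm
      tauto
    · exact htwins hzu hzv hzv' x

theorem not_adj_of_twin (hG : G.IsMinimallyKConnected 2) {a b p q v w : V} (hwu : w ≠ u)
    (hw : ∀ x, G.Adj w x ↔ G.Adj u x) (hab : G.Adj a b) (hua : ¬ G.Adj u a) (hub : ¬ G.Adj u b)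
    (hup : G.Adj u p) (hap : G.Adj a p) (huq : G.Adj u q) (hbq : G.Adj b q) (huv : G.Adj u v)
    (hpq : p ≠ q) (hvp : v ≠ p) (hvq : v ≠ q) : ¬ G.Adj a v := by
  intro hav
  have hne {c d : V} (huc : ¬ G.Adj u c) (hud : G.Adj u d) : c ≠ d := fun h => huc (h ▸ hud)
  have hau : a ≠ u := fun h => hub (h ▸ hab)
  have hbu : b ≠ u := fun h => hua (h ▸ hab.symm)
  have haw : a ≠ w := fun h => hub ((hw b).1 (h ▸ hab))
  have hbw : b ≠ w := fun h => hua ((hw a).1 (h ▸ hab.symm))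
  have huw : ¬ G.Adj u w := fun h => G.irrefl ((hw w).2 h)
  have hdisj : ∀ z ∈
      (Walk.cons hap (Walk.cons ((hw p).2 hup).symm (Walk.cons ((hw v).2 huv) Walk.nil))).support,
      z ∈ (Walk.cons hab (Walk.cons hbq (Walk.cons huq.symm (Walk.cons huv Walk.nil)))).support →
        z = a ∨ z = v := by
    have := hne hub hup
    have := hne huw huq
    have := hup.ne
    simp only [Walk.support_cons, Walk.support_nil, List.mem_cons, List.not_mem_nil, or_false]
    rintro z (rfl | rfl | rfl | rfl) (h | h | h | h | h) <;> tauto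
  rcases mem_edges_of_disjoint_walks hG hav _ _ hdisj with h | h
  · simp [hne hua hup, hvp, haw, hne hua huv] at h
  · simp [(hne hub huv).symm, hab.ne, hvq, hau, hne hua huq, hne hua huv] at h

end BipartiteStructure

section Matrix

open Matrix

variable {n : Type*} [Fintype n] {A : Matrix n n ℝ} {r s : ℝ} {x y : n → ℝ}

theorem posSemidef_algebraMap_sub [DecidableEq n] (hA : A.IsHermitian)
    (hr : r ∈ upperBounds (spectrum ℝ A)) : (algebraMap ℝ (Matrix n n ℝ) r - A).PosSemidef := by
  rw [posSemidef_iff_isHermitian_and_spectrum_nonneg, ← spectrum.singleton_sub_eq]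
  refine ⟨IsSelfAdjoint.sub ((IsSelfAdjoint.all r).algebraMap _) hA, ?_⟩
  rintro _ ⟨_, rfl, μ, hμ, rfl⟩
  exact sub_nonneg.2 (hr hμ)

theorem mulVec_abs_of_mulVec_eq_smul [DecidableEq n] (hA : A.IsHermitian)
    (hpos : ∀ i j, 0 ≤ A i j) (hr : r ∈ upperBounds (spectrum ℝ A)) (hx : A *ᵥ x = r • x) :
    A *ᵥ |x| = r • |x| := by
  have hM := posSemidef_algebraMap_sub hA hr
  have hMv (v : n → ℝ) : (algebraMap ℝ (Matrix n n ℝ) r - A) *ᵥ v = r • v - A *ᵥ v := by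
    rw [sub_mulVec, Algebra.algebraMap_eq_smul_one, smul_mulVec, one_mulVec]
  have hle : x ⬝ᵥ A *ᵥ x ≤ |x| ⬝ᵥ A *ᵥ |x| := by
    simp only [dotProduct, mulVec, mul_sum]
    refine sum_le_sum fun i _ => sum_le_sum fun j _ => (le_abs_self _).trans_eq ?_
    rw [abs_mul, abs_mul, abs_of_nonneg (hpos i j), Pi.abs_apply, Pi.abs_apply]
  have habs : |x| ⬝ᵥ |x| = x ⬝ᵥ x := sum_congr rfl fun i _ => abs_mul_abs_self (x i)
  have hzero := hM.dotProduct_mulVec_zero_iff |x|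
  have hge := hM.dotProduct_mulVec_nonneg |x|
  rw [star_trivial, hMv, dotProduct_sub, dotProduct_smul, habs] at hzero hge
  rw [hx, dotProduct_smul] at hle
  exact (sub_eq_zero.1 (hzero.1 (le_antisymm (sub_nonpos.2 hle) hge))).symm

theorem eigenvalue_eq_of_pos_of_nonneg (hA : A.IsSymm) (hx : ∀ i, 0 < x i) (hAx : A *ᵥ x = s • x)
    (hy : 0 ≤ y) (hy0 : y ≠ 0) (hAy : A *ᵥ y = r • y) : r = s := by
  have hxy : 0 < x ⬝ᵥ y := by
    obtain ⟨i, hi⟩ := Function.ne_iff.1 hy0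
    exact sum_pos' (fun j _ => mul_nonneg (hx j).le (hy j))
      ⟨i, mem_univ i, mul_pos (hx i) ((hy i).lt_of_ne' hi)⟩
  have h : x ⬝ᵥ A *ᵥ y = A *ᵥ x ⬝ᵥ y := by rw [dotProduct_mulVec, ← mulVec_transpose, hA]
  rw [hAx, hAy, dotProduct_smul, smul_dotProduct] at h
  exact mul_right_cancel₀ hxy.ne' h

end Matrix

section SpectralRadius

open Matrix

variable {V W : Type*} [Fintype V] [DecidableEq V] [Fintype W] [DecidableEq W]
  {G : SimpleGraph V} [DecidableRel G.Adj] {H : SimpleGraph W} [DecidableRel H.Adj]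

/-- A Perron vector of `G`, that is a nonnegative eigenvector of the adjacency matrix for the
eigenvalue `ρ(G)`, scaled so that its largest entry is `1` and occurs at the vertex `u`. -/
structure IsPerronVectorAt (G : SimpleGraph V) [DecidableRel G.Adj] (u : V) (y : V → ℝ) :
    Prop where
  nonneg : ∀ v, 0 ≤ y v
  le_one : ∀ v, y v ≤ 1
  apply_eq_one : y u = 1
  sum_neighborFinset : ∀ v, ∑ w ∈ G.neighborFinset v, y w = G.rho * y v

theorem setOf_hasEigenvalue_eq_spectrum :
    {μ : ℝ | Module.End.HasEigenvalue (toLin' (G.adjMatrix ℝ)) μ} = spectrum ℝ (G.adjMatrix ℝ) := by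
  rw [← spectrum_toLin']
  ext
  exact Module.End.hasEigenvalue_iff_mem_spectrum

theorem exists_isPerronVectorAt [Nonempty V] (G : SimpleGraph V) [DecidableRel G.Adj] :
    ∃ u y, IsPerronVectorAt G u y := by
  have hrho := isGreatest_rho G
  obtain ⟨x, hx, hx0⟩ := hrho.1.exists_hasEigenvector
  rw [setOf_hasEigenvalue_eq_spectrum] at hrho
  rw [Module.End.mem_eigenspace_iff, toLin'_apply] at hx
  have habs := mulVec_abs_of_mulVec_eq_smul
    ((conjTranspose_eq_transpose_of_trivial _).trans G.isSymm_adjMatrix)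
    (fun i j => by rw [adjMatrix_apply]; positivity) hrho.2 hx
  obtain ⟨u, hu⟩ := Finite.exists_max |x|
  have hpos : 0 < |x| u := by
    obtain ⟨v, hv⟩ := Function.ne_iff.1 hx0
    exact (abs_pos.2 hv).trans_le (hu v)
  refine ⟨u, fun v => |x| v / |x| u, fun v => div_nonneg (abs_nonneg _) hpos.le,
    fun v => (div_le_one hpos).2 (hu v), div_self hpos.ne', fun v => ?_⟩
  have hv := congrFun habs v
  rw [adjMatrix_mulVec_apply, Pi.smul_apply, smul_eq_mul] at hv
  rw [← sum_div, hv, mul_div_assoc]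

theorem rho_eq_of_pos [Nonempty V] {z : V → ℝ} {r : ℝ} (hz : ∀ v, 0 < z v)
    (h : G.adjMatrix ℝ *ᵥ z = r • z) : G.rho = r := by
  obtain ⟨u, y, hy⟩ := exists_isPerronVectorAt G
  refine eigenvalue_eq_of_pos_of_nonneg (G.isSymm_adjMatrix (α := ℝ)) hz h hy.nonneg ?_ ?_
  · exact fun h0 => one_ne_zero (hy.apply_eq_one.symm.trans (congrFun h0 u))
  · ext v
    rw [adjMatrix_mulVec_apply, hy.sum_neighborFinset, Pi.smul_apply, smul_eq_mul]

theorem rho_eq_of_iso (φ : G ≃g H) : G.rho = H.rho := by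
  unfold rho
  rw [setOf_hasEigenvalue_eq_spectrum, setOf_hasEigenvalue_eq_spectrum, ← φ.reindex_adjMatrix ℝ]
  exact congrArg sSup (AlgEquiv.spectrum_eq (reindexAlgEquiv ℝ ℝ φ.toEquiv) _).symm

end SpectralRadius

section ExtremalSpectralRadius

open Matrix

theorem card_edgeFinset_of_iso_completeBipartiteGraph {V α β : Type*} [Fintype α] [Fintype β]
    {G : SimpleGraph V} [Fintype G.edgeSet] (φ : G ≃g completeBipartiteGraph α β) :
    #G.edgeFinset = Fintype.card α * Fintype.card β := by
  classical
  rw [φ.card_edgeFinset_eq, ← Nat.cast_inj (R := ℕ∞), ← Set.encard_coe_eq_coe_finsetCard,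
    coe_edgeFinset, encard_edgeSet_completeBipartiteGraph]
  simp

theorem rho_completeBipartiteGraph {α β : Type*} [Fintype α] [Fintype β] [DecidableEq α]
    [DecidableEq β] [Nonempty α] [Nonempty β] [DecidableRel (completeBipartiteGraph α β).Adj] :
    (completeBipartiteGraph α β).rho = √(Fintype.card α * Fintype.card β) := by
  have hα := Real.mul_self_sqrt (Nat.cast_nonneg (α := ℝ) (Fintype.card α))
  have hβ := Real.mul_self_sqrt (Nat.cast_nonneg (α := ℝ) (Fintype.card β))
  rw [Real.sqrt_mul (Nat.cast_nonneg _)]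
  refine rho_eq_of_pos (z := Sum.elim (fun _ => √(Fintype.card β)) fun _ => √(Fintype.card α)) ?_ ?_
  · rintro (_ | _) <;> exact Real.sqrt_pos.2 (Nat.cast_pos.2 Fintype.card_pos)
  · ext (_ | _)
    · have heq : Fintype.card β * √(Fintype.card α) =
          √(Fintype.card α) * √(Fintype.card β) * √(Fintype.card β) := by
        linear_combination (-√(Fintype.card α)) * hβ
      simpa [mulVec, dotProduct, adjMatrix_apply] using heq
    · have heq : Fintype.card α * √(Fintype.card β) =
          √(Fintype.card α) * √(Fintype.card β) * √(Fintype.card α) := by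
        linear_combination (-√(Fintype.card β)) * hα
      simpa [mulVec, dotProduct, adjMatrix_apply] using heq

theorem sum_ite_eq_add_mul {ι : Type*} [Fintype ι] [DecidableEq ι] (i : ι) (c d : ℝ) :
    ∑ k, (if k = i then c else d) = c + (Fintype.card ι - 1) * d := by
  rw [← add_sum_erase univ _ (mem_univ i), if_pos rfl, sum_congr rfl fun _ hk =>
    if_neg (ne_of_mem_erase hk), sum_const, card_erase_of_mem (mem_univ i), card_univ,
    nsmul_eq_mul, Nat.cast_pred (Fintype.card_pos_iff.2 ⟨i⟩)]

theorem exists_eq_of_mem_edgeSet_completeBipartiteGraph {α β : Type*} {e : Sym2 (α ⊕ β)}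
    (he : e ∈ (completeBipartiteGraph α β).edgeSet) : ∃ a b, e = s(Sum.inl a, Sum.inr b) := by
  induction e with
  | _ x y =>
    rw [mem_edgeSet, completeBipartiteGraph_adj] at he
    rcases x with a | b <;> rcases y with a' | b'
    · simp at he
    · exact ⟨a, b', rfl⟩
    · exact ⟨a', b, Sym2.eq_swap⟩
    · simp at he

theorem rho_subdivideEdge_completeBipartiteGraph_two {n : ℕ} {e : Sym2 (Fin 2 ⊕ Fin n)}
    [DecidableRel ((completeBipartiteGraph (Fin 2) (Fin n)).subdivideEdge e).Adj]
    (he : e ∈ (completeBipartiteGraph (Fin 2) (Fin n)).edgeSet) {r : ℝ} (hr : 1 < r)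
    (h : (r - 1) * (r ^ 2 - (2 * n - 1)) = 1) :
    ((completeBipartiteGraph (Fin 2) (Fin n)).subdivideEdge e).rho = r := by
  classical
  obtain ⟨i, j, rfl⟩ := exists_eq_of_mem_edgeSet_completeBipartiteGraph he
  refine rho_eq_of_pos (z := fun o => o.elim r (Sum.elim (fun _ => r * (r - 1))
    fun k => if k = j then r else 2 * (r - 1))) ?_ ?_
  · rintro (_ | _ | _)
    · exact zero_lt_one.trans hr
    · exact mul_pos (by linarith) (by linarith)
    · dsimp only [Option.elim, Sum.elim]
      split_ifs <;> linarith
  · ext v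
    simp only [mulVec, dotProduct, adjMatrix_apply, ite_mul, one_mul, zero_mul, Pi.smul_apply,
      smul_eq_mul, Fintype.sum_option, Fintype.sum_sum_type]
    rcases v with (_ | k | k)
    · have heq : r * (r - 1) + r = r * r := by ring
      simpa [subdivideEdge] using heq
    · by_cases hk : k = i
      · subst hk
        have hne : ∀ x : Fin n, (if x = j then 0 else if x = j then r else 2 * (r - 1)) =
            if x = j then 0 else 2 * (r - 1) := fun x => by split_ifs <;> rfl
        have heq : r + (n - 1) * (2 * (r - 1)) = r * (r * (r - 1)) := by linear_combination -h
        simpa [subdivideEdge, hne, sum_ite_eq_add_mul] using heq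
      · have heq : r + (n - 1) * (2 * (r - 1)) = r * (r * (r - 1)) := by linear_combination -h
        simpa [subdivideEdge, hk, sum_ite_eq_add_mul] using heq
    · by_cases hk : k = j
      · subst hk
        have heq : r + (2 - 1) * (r * (r - 1)) = r * r := by ring
        simpa [subdivideEdge, sum_ite_eq_add_mul] using heq
      · have heq : 2 * (r * (r - 1)) = r * (2 * (r - 1)) := by ring
        simpa [subdivideEdge, hk] using heq

end ExtremalSpectralRadius

section EdgeCount

variable {V : Type*} [Fintype V] [DecidableEq V] {G : SimpleGraph V} [DecidableRel G.Adj] {u : V}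

/-- The common neighbours of `u` and `w`, as a finset. -/
def commonNeighborFinset (G : SimpleGraph V) [DecidableRel G.Adj] (u w : V) : Finset V :=
  G.neighborFinset u ∩ G.neighborFinset w

/-- The edges of `G` that avoid the neighbourhood of `u`. They count the gap between `ρ(G) ^ 2` and
the number of edges when `u` is a vertex with maximal Perron entry. -/
def farEdgeFinset (G : SimpleGraph V) [DecidableRel G.Adj] (u : V) : Finset (Sym2 V) :=
  {e ∈ G.edgeFinset | ∀ v ∈ G.neighborFinset u, v ∉ e}

theorem mem_commonNeighborFinset {w v : V} :
    v ∈ commonNeighborFinset G u w ↔ G.Adj u v ∧ G.Adj w v := by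
  simp [commonNeighborFinset]

theorem mk_mem_farEdgeFinset {a b : V} :
    s(a, b) ∈ farEdgeFinset G u ↔ G.Adj a b ∧ ¬ G.Adj u a ∧ ¬ G.Adj u b := by
  simp only [farEdgeFinset, mem_filter, mem_edgeFinset, mem_edgeSet, mem_neighborFinset,
    Sym2.mem_iff, not_or]
  exact and_congr_right fun _ => ⟨fun h => ⟨fun ha => (h a ha).1 rfl, fun hb => (h b hb).2 rfl⟩,
    fun h v hv => ⟨fun hva => h.1 (hva ▸ hv), fun hvb => h.2 (hvb ▸ hv)⟩⟩

theorem card_edgeFinset_eq_sum_degree_add {s : Finset V} (hs : G.IsIndepSet s) :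
    #G.edgeFinset = ∑ v ∈ s, G.degree v + #{e ∈ G.edgeFinset | ∀ v ∈ s, v ∉ e} := by
  have hdisj : (s : Set V).PairwiseDisjoint fun v => G.incidenceFinset v := by
    intro v hv w hw hvw
    rw [Function.onFun, Finset.disjoint_left]
    intro e hev hew
    rw [mem_incidenceFinset] at hev hew
    exact hs hv hw hvw (G.adj_of_mem_incidenceSet hvw hev hew)
  rw [← card_filter_add_card_filter_not (s := G.edgeFinset) (fun e => ∃ v ∈ s, v ∈ e)]
  congr 1
  · rw [← sum_congr rfl fun v _ => G.card_incidenceFinset_eq_degree v, ← card_biUnion hdisj]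
    congr 1
    ext e
    simp only [mem_filter, mem_biUnion, incidenceFinset_eq_filter]
    tauto
  · simp

theorem sum_sum_neighborFinset_of_cliqueFree_three {M : Type*} [AddCommMonoid M]
    (hT : G.CliqueFree 3) (u : V) (f : V → M) :
    ∑ v ∈ G.neighborFinset u, ∑ w ∈ G.neighborFinset v, f w = G.degree u • f u +
      ∑ w ∈ Gᶜ.neighborFinset u, #(commonNeighborFinset G u w) • f w := by
  have hswap : ∑ v ∈ G.neighborFinset u, ∑ w ∈ G.neighborFinset v, f w =
      ∑ w, ∑ _v ∈ commonNeighborFinset G u w, f w :=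
    sum_comm' (by simp [mem_commonNeighborFinset, G.adj_comm])
  have hself : commonNeighborFinset G u u = G.neighborFinset u := inter_self _
  have hnbr : ∀ w ∉ insert u (Gᶜ.neighborFinset u), commonNeighborFinset G u w = ∅ := by
    intro w hw
    simp only [mem_insert, mem_neighborFinset, compl_adj, not_or, not_and, not_not] at hw
    refine eq_empty_of_forall_notMem fun v hv => ?_
    rw [mem_commonNeighborFinset] at hv
    exact not_adj_of_cliqueFree_three hT (hw.2 (Ne.symm hw.1)) hv.1 hv.2
  simp only [hswap, sum_const]
  rw [← sum_subset (subset_univ (insert u (Gᶜ.neighborFinset u))) fun w _ hw => by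
    rw [hnbr w hw, card_empty, zero_smul], sum_insert (Gᶜ.notMem_neighborFinset_self u), hself,
    card_neighborFinset_eq_degree]

theorem card_edgeFinset_eq_of_cliqueFree_three (hT : G.CliqueFree 3) (u : V) :
    #G.edgeFinset = G.degree u + ∑ w ∈ Gᶜ.neighborFinset u, #(commonNeighborFinset G u w) +
      #(farEdgeFinset G u) := by
  have hindep : G.IsIndepSet (G.neighborFinset u) := by
    rw [coe_neighborFinset]
    exact G.isIndepSet_neighborSet_of_triangleFree hT u
  have hsum := sum_sum_neighborFinset_of_cliqueFree_three hT u fun _ => 1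
  simp only [sum_const, card_neighborFinset_eq_degree, smul_eq_mul, mul_one] at hsum
  rw [card_edgeFinset_eq_sum_degree_add hindep, hsum, farEdgeFinset]

end EdgeCount

section SpectralBound

variable {V : Type*} [Fintype V] [DecidableEq V] {G : SimpleGraph V} [DecidableRel G.Adj] {u : V}
  {y : V → ℝ}

namespace IsPerronVectorAt

theorem rho_eq_sum (hy : IsPerronVectorAt G u y) : G.rho = ∑ v ∈ G.neighborFinset u, y v := by
  rw [hy.sum_neighborFinset, hy.apply_eq_one, mul_one]

theorem rho_sq_eq (hy : IsPerronVectorAt G u y) (hT : G.CliqueFree 3) :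
    G.rho ^ 2 = G.degree u +
      ∑ w ∈ Gᶜ.neighborFinset u, #(commonNeighborFinset G u w) * y w := by
  have hsum := sum_sum_neighborFinset_of_cliqueFree_three hT u y
  simp only [hy.sum_neighborFinset, hy.apply_eq_one, nsmul_eq_mul, mul_one] at hsum
  rw [← hsum, ← mul_sum, ← hy.rho_eq_sum, sq]

theorem card_edgeFinset_eq (hy : IsPerronVectorAt G u y) (hT : G.CliqueFree 3) :
    (#G.edgeFinset : ℝ) = G.rho ^ 2 + #(farEdgeFinset G u) +
      ∑ w ∈ Gᶜ.neighborFinset u, #(commonNeighborFinset G u w) * (1 - y w) := by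
  rw [hy.rho_sq_eq hT, card_edgeFinset_eq_of_cliqueFree_three hT u]
  simp only [mul_sub, mul_one, sum_sub_distrib]
  push_cast
  ring

theorem rho_sq_add_le (hy : IsPerronVectorAt G u y) (hT : G.CliqueFree 3) :
    G.rho ^ 2 + #(farEdgeFinset G u) ≤ #G.edgeFinset := by
  rw [hy.card_edgeFinset_eq hT]
  exact le_add_of_nonneg_right <| sum_nonneg fun w _ =>
    mul_nonneg (Nat.cast_nonneg _) (sub_nonneg.2 (hy.le_one w))

end IsPerronVectorAt

theorem rho_le_sqrt_card_edgeFinset [Nonempty V] (hT : G.CliqueFree 3) :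
    G.rho ≤ √(#G.edgeFinset) := by
  obtain ⟨u, y, hy⟩ := exists_isPerronVectorAt G
  exact Real.le_sqrt_of_sq_le (le_trans (by simp) (hy.rho_sq_add_le hT))

theorem exists_iso_completeBipartiteGraph_two_of_farEdgeFinset_eq_empty
    (hG : G.IsMinimallyKConnected 2) (hT : G.CliqueFree 3) (hfar : farEdgeFinset G u = ∅) :
    ∃ n, Nonempty (G ≃g completeBipartiteGraph (Fin 2) (Fin n)) := by
  refine exists_iso_completeBipartiteGraph_two_of_forall_adj_neighbor hG hT (u := u)
    fun a b hab => ?_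
  by_contra! h
  exact notMem_empty s(a, b) (hfar ▸ mk_mem_farEdgeFinset.2 ⟨hab, h⟩)

theorem exists_iso_completeBipartiteGraph_two_of_rho_eq_sqrt [Nonempty V]
    (hG : G.IsMinimallyKConnected 2) (hT : G.CliqueFree 3) (hrho : G.rho = √(#G.edgeFinset)) :
    ∃ n, Nonempty (G ≃g completeBipartiteGraph (Fin 2) (Fin n)) := by
  obtain ⟨u, y, hy⟩ := exists_isPerronVectorAt G
  have hle := hy.rho_sq_add_le hT
  rw [hrho, Real.sq_sqrt (Nat.cast_nonneg _), add_le_iff_nonpos_right, Nat.cast_nonpos,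
    card_eq_zero] at hle
  exact exists_iso_completeBipartiteGraph_two_of_farEdgeFinset_eq_empty hG hT hle

theorem exists_farEdgeFinset_eq_singleton (hG : G.IsMinimallyKConnected 2) (hT : G.CliqueFree 3)
    (hodd : Odd #G.edgeFinset) (hy : IsPerronVectorAt G u y)
    (hrho : (#G.edgeFinset : ℝ) - 2 < G.rho ^ 2) : ∃ a b, farEdgeFinset G u = {s(a, b)} := by
  have hlt : #(farEdgeFinset G u) < 2 := by
    rw [← Nat.cast_lt (α := ℝ), Nat.cast_ofNat]
    linarith [hy.rho_sq_add_le hT]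
  have hne : #(farEdgeFinset G u) ≠ 0 := by
    intro h0
    obtain ⟨n, ⟨φ⟩⟩ := exists_iso_completeBipartiteGraph_two_of_farEdgeFinset_eq_empty hG hT
      (card_eq_zero.1 h0)
    rw [card_edgeFinset_of_iso_completeBipartiteGraph φ, Fintype.card_fin] at hodd
    exact Nat.not_odd_iff_even.2 (even_two_mul _) hodd
  obtain ⟨e, he⟩ := card_eq_one.1 (show #(farEdgeFinset G u) = 1 by omega)
  induction e with
  | _ a b => exact ⟨a, b, he⟩

end SpectralBound

section SingleFarEdge

variable {V : Type*} [Fintype V] [DecidableEq V] {G : SimpleGraph V} [DecidableRel G.Adj]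
  {u a b : V} {y : V → ℝ}

theorem adj_iff_mem_commonNeighborFinset_or {w x : V} (huw : ¬ G.Adj u w) :
    G.Adj w x ↔ x ∈ commonNeighborFinset G u w ∨ s(w, x) ∈ farEdgeFinset G u := by
  rw [mem_commonNeighborFinset, mk_mem_farEdgeFinset]
  tauto

theorem commonNeighborFinset_nonempty (hG : G.IsKConnected 2)
    (hfar : farEdgeFinset G u = {s(a, b)}) {w : V} (huw : ¬ G.Adj u w) :
    (commonNeighborFinset G u w).Nonempty := by
  obtain ⟨x, hwx, hx⟩ := exists_adj_ne_of_isKConnected le_rfl hG w (if w = a then b else a)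
  refine ⟨x, ((adj_iff_mem_commonNeighborFinset_or huw).1 hwx).resolve_right fun h => hx ?_⟩
  rw [hfar, mem_singleton, Sym2.eq_iff] at h
  rcases h with ⟨rfl, rfl⟩ | ⟨rfl, rfl⟩
  · rw [if_pos rfl]
  · split_ifs with h
    exacts [h.symm, rfl]

theorem disjoint_commonNeighborFinset_of_adj (hT : G.CliqueFree 3) (hab : G.Adj a b) :
    Disjoint (commonNeighborFinset G u a) (commonNeighborFinset G u b) := by
  refine Finset.disjoint_left.2 fun v hva hvb => ?_
  rw [mem_commonNeighborFinset] at hva hvb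
  exact not_adj_of_cliqueFree_three hT hab hva.2 hvb.2

theorem adj_of_farEdgeFinset_eq_singleton (hfar : farEdgeFinset G u = {s(a, b)}) :
    G.Adj a b ∧ ¬ G.Adj u a ∧ ¬ G.Adj u b :=
  mk_mem_farEdgeFinset.1 (hfar ▸ mem_singleton_self _)

theorem adj_iff_of_farEdgeFinset_eq_singleton (hfar : farEdgeFinset G u = {s(a, b)}) {x : V} :
    G.Adj a x ↔ x = b ∨ x ∈ commonNeighborFinset G u a := by
  have hua := (adj_of_farEdgeFinset_eq_singleton hfar).2.1
  rw [adj_iff_mem_commonNeighborFinset_or hua, hfar, mem_singleton, Sym2.congr_right, or_comm]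

theorem pair_subset_neighborFinset_compl (hfar : farEdgeFinset G u = {s(a, b)}) :
    {a, b} ⊆ Gᶜ.neighborFinset u := by
  obtain ⟨hab, hua, hub⟩ := adj_of_farEdgeFinset_eq_singleton hfar
  simp only [insert_subset_iff, singleton_subset_iff, mem_neighborFinset, compl_adj]
  exact ⟨⟨fun h => hub (h ▸ hab), hua⟩, fun h => hua (h ▸ hab.symm), hub⟩

theorem five_lt_card_edgeFinset (hG : G.IsKConnected 2) (hT : G.CliqueFree 3)
    (hfar : farEdgeFinset G u = {s(a, b)}) (hW : {a, b} ⊂ Gᶜ.neighborFinset u) :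
    5 < #G.edgeFinset := by
  have hab := (adj_of_farEdgeFinset_eq_singleton hfar).1.ne
  have hcard := card_lt_card hW
  have hsum : #(Gᶜ.neighborFinset u) ≤
      ∑ w ∈ Gᶜ.neighborFinset u, #(commonNeighborFinset G u w) := by
    rw [card_eq_sum_ones]
    refine sum_le_sum fun w hw => card_pos.2 (commonNeighborFinset_nonempty hG hfar ?_)
    exact ((Gᶜ.mem_neighborFinset u w).1 hw).2
  have hdeg := le_degree_of_isKConnected hG u
  have hm := card_edgeFinset_eq_of_cliqueFree_three hT u
  rw [hfar, card_singleton] at hm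
  rw [card_pair hab] at hcard
  omega

theorem card_edgeFinset_eq_two_mul_degree_add_one (hT : G.CliqueFree 3)
    (hfar : farEdgeFinset G u = {s(a, b)}) (hW : Gᶜ.neighborFinset u = {a, b})
    (hN : G.neighborFinset u = commonNeighborFinset G u a ∪ commonNeighborFinset G u b) :
    #G.edgeFinset = 2 * G.degree u + 1 := by
  have hab := (adj_of_farEdgeFinset_eq_singleton hfar).1
  rw [card_edgeFinset_eq_of_cliqueFree_three hT u, hW, sum_pair hab.ne,
    ← card_union_of_disjoint (disjoint_commonNeighborFinset_of_adj hT hab), ← hN,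
    card_neighborFinset_eq_degree, hfar, card_singleton, two_mul]

theorem exists_iso_subdivideEdge_of_card_commonNeighborFinset_eq_one (hT : G.CliqueFree 3)
    (hfar : farEdgeFinset G u = {s(a, b)}) (hW : Gᶜ.neighborFinset u = {a, b})
    (hN : G.neighborFinset u = commonNeighborFinset G u a ∪ commonNeighborFinset G u b)
    (hb : #(commonNeighborFinset G u b) = 1) :
    ∃ e ∈ (completeBipartiteGraph (Fin 2) (Fin (G.degree u))).edgeSet,
      Nonempty (G ≃g (completeBipartiteGraph (Fin 2) (Fin (G.degree u))).subdivideEdge e) := by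
  obtain ⟨hab, hua, hub⟩ := adj_of_farEdgeFinset_eq_singleton hfar
  obtain ⟨q, hq⟩ := card_eq_one.1 hb
  have hq' : ∀ v, G.Adj u v → (G.Adj b v ↔ v = q) := fun v huv => by
    rw [← mem_singleton, ← hq, mem_commonNeighborFinset, and_iff_right huv]
  have huq : G.Adj u q := (mem_commonNeighborFinset.1 (hq ▸ mem_singleton_self q)).1
  refine exists_iso_subdivideEdge (a := a) (b := b) (q := q) (fun h => hub (h ▸ hab))
    (fun h => hua (h ▸ hab.symm)) hab.ne hua hub (fun w huw => or_iff_not_imp_left.2 fun hwu => ?_)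
    (fun v w => not_adj_of_cliqueFree_three hT) huq (fun v => ?_) fun v huv => ?_
  · have hw : w ∈ Gᶜ.neighborFinset u := (mem_neighborFinset _ _ _).2 ⟨Ne.symm hwu, huw⟩
    simpa [hW] using hw
  · rw [adj_iff_of_farEdgeFinset_eq_singleton (hfar.trans (by rw [Sym2.eq_swap])), hq,
      mem_singleton]
  · rw [Ne, ← hq' v huv]
    refine ⟨not_adj_of_cliqueFree_three hT hab, fun hbv => ?_⟩
    have hv : v ∈ G.neighborFinset u := (mem_neighborFinset _ _ _).2 huv
    rw [hN, mem_union, mem_commonNeighborFinset, mem_commonNeighborFinset] at hv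
    exact (hv.resolve_right fun h => hbv h.2).2

end SingleFarEdge

section OddEdgeCount

variable {V : Type*} [Fintype V] [DecidableEq V] {G : SimpleGraph V} [DecidableRel G.Adj]
  {u a b : V} {y : V → ℝ}

namespace IsPerronVectorAt

theorem pos_of_adj (hy : IsPerronVectorAt G u y) {v : V} (huv : G.Adj u v) : 0 < y v := by
  have hle : y u ≤ ∑ w ∈ G.neighborFinset v, y w :=
    single_le_sum (fun w _ => hy.nonneg w) ((G.mem_neighborFinset v u).2 huv.symm)
  rw [hy.sum_neighborFinset, hy.apply_eq_one] at hle
  refine (hy.nonneg v).lt_of_ne fun h => ?_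
  rw [← h, mul_zero] at hle
  exact zero_lt_one.not_ge hle

theorem neighborFinset_subset_of_sum_sdiff_nonpos (hy : IsPerronVectorAt G u y) {s : Finset V}
    (hs : ∑ v ∈ G.neighborFinset u \ s, y v ≤ 0) : G.neighborFinset u ⊆ s := by
  rw [← sdiff_eq_empty_iff_subset, ← not_nonempty_iff_eq_empty]
  refine fun hne => hs.not_gt (sum_pos (fun v hv => hy.pos_of_adj ?_) hne)
  exact (G.mem_neighborFinset u v).1 (sdiff_subset hv)

theorem neighborFinset_eq_of_apply_eq_one (hy : IsPerronVectorAt G u y) {w : V} (hw : y w = 1)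
    (hsub : G.neighborFinset w ⊆ G.neighborFinset u) :
    G.neighborFinset w = G.neighborFinset u := by
  refine hsub.antisymm (hy.neighborFinset_subset_of_sum_sdiff_nonpos (le_of_eq ?_))
  rw [sum_sdiff_eq_sub hsub, hy.sum_neighborFinset, hy.sum_neighborFinset, hw, hy.apply_eq_one,
    sub_self]

theorem rho_le_degree (hy : IsPerronVectorAt G u y) : G.rho ≤ G.degree u := by
  rw [hy.rho_eq_sum]
  exact (sum_le_card_nsmul _ y 1 fun v _ => hy.le_one v).trans (by simp)

theorem rho_sub_one_mul_add (hy : IsPerronVectorAt G u y) (hT : G.CliqueFree 3)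
    (hfar : farEdgeFinset G u = {s(a, b)}) :
    (G.rho - 1) * (y a + y b) = G.rho -
      ∑ v ∈ G.neighborFinset u \ (commonNeighborFinset G u a ∪ commonNeighborFinset G u b),
        y v := by
  have hab := (adj_of_farEdgeFinset_eq_singleton hfar).1
  have hsum {c d : V} (h : farEdgeFinset G u = {s(c, d)}) :
      G.rho * y c = y d + ∑ v ∈ commonNeighborFinset G u c, y v := by
    have hN : G.neighborFinset c = insert d (commonNeighborFinset G u c) := by
      ext x
      rw [mem_neighborFinset, mem_insert, adj_iff_of_farEdgeFinset_eq_singleton h]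
    have hd : d ∉ commonNeighborFinset G u c := fun hd =>
      (adj_of_farEdgeFinset_eq_singleton h).2.2 (mem_commonNeighborFinset.1 hd).1
    rw [← hy.sum_neighborFinset, hN, sum_insert hd]
  have hsub : commonNeighborFinset G u a ∪ commonNeighborFinset G u b ⊆ G.neighborFinset u :=
    union_subset inter_subset_left inter_subset_left
  rw [sum_sdiff_eq_sub hsub, ← hy.rho_eq_sum,
    sum_union (disjoint_commonNeighborFinset_of_adj hT hab)]
  linear_combination hsum hfar + hsum (hfar.trans (congrArg _ Sym2.eq_swap))

theorem rho_sub_one_mul_rho_sq_sub (hy : IsPerronVectorAt G u y) (hT : G.CliqueFree 3)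
    (hfar : farEdgeFinset G u = {s(a, b)}) :
    (G.rho - 1) * (G.rho ^ 2 - (#G.edgeFinset - 2)) = 1 -
      ∑ v ∈ G.neighborFinset u \ (commonNeighborFinset G u a ∪ commonNeighborFinset G u b), y v -
      (G.rho - 1) * (∑ w ∈ Gᶜ.neighborFinset u \ {a, b},
          #(commonNeighborFinset G u w) * (1 - y w) +
        ∑ w ∈ {a, b}, (#(commonNeighborFinset G u w) - 1) * (1 - y w)) := by
  have hab := (adj_of_farEdgeFinset_eq_singleton hfar).1.ne
  have hm := hy.card_edgeFinset_eq hT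
  rw [hfar, card_singleton, Nat.cast_one,
    ← sum_sdiff (pair_subset_neighborFinset_compl hfar)] at hm
  rw [hm, sum_pair hab, sum_pair hab]
  linear_combination hy.rho_sub_one_mul_add hT hfar

theorem tight_of_one_le (hy : IsPerronVectorAt G u y) (hG : G.IsKConnected 2)
    (hT : G.CliqueFree 3) (hfar : farEdgeFinset G u = {s(a, b)}) (hrho : 1 < G.rho)
    (h : 1 ≤ (G.rho - 1) * (G.rho ^ 2 - (#G.edgeFinset - 2))) :
    G.neighborFinset u = commonNeighborFinset G u a ∪ commonNeighborFinset G u b ∧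
      (∀ w ∈ Gᶜ.neighborFinset u \ {a, b}, y w = 1) ∧
      ∀ w ∈ ({a, b} : Finset V), #(commonNeighborFinset G u w) = 1 ∨ y w = 1 := by
  have hW {w : V} (hw : w ∈ Gᶜ.neighborFinset u) : 1 ≤ (#(commonNeighborFinset G u w) : ℝ) :=
    Nat.one_le_cast.2 <| card_pos.2 <|
      commonNeighborFinset_nonempty hG hfar ((Gᶜ.mem_neighborFinset u w).1 hw).2
  have hloss (w : V) : 0 ≤ 1 - y w := sub_nonneg.2 (hy.le_one w)
  have hother : ∀ w ∈ Gᶜ.neighborFinset u \ {a, b},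
      0 ≤ (#(commonNeighborFinset G u w) : ℝ) * (1 - y w) := fun w _ =>
    mul_nonneg (Nat.cast_nonneg _) (hloss w)
  have hpair : ∀ w ∈ ({a, b} : Finset V),
      0 ≤ ((#(commonNeighborFinset G u w) : ℝ) - 1) * (1 - y w) := fun w hw =>
    mul_nonneg (sub_nonneg.2 (hW (pair_subset_neighborFinset_compl hfar hw))) (hloss w)
  have hR : 0 ≤ ∑ v ∈ G.neighborFinset u \
      (commonNeighborFinset G u a ∪ commonNeighborFinset G u b), y v :=
    sum_nonneg fun v _ => hy.nonneg v
  have hO := sum_nonneg hother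
  have hP := sum_nonneg hpair
  have hprod := mul_nonneg (sub_nonneg.2 hrho.le) (add_nonneg hO hP)
  rw [hy.rho_sub_one_mul_rho_sq_sub hT hfar] at h
  have hzero := (mul_eq_zero.1 (hprod.antisymm' (by linarith))).resolve_left
    (sub_ne_zero.2 hrho.ne')
  rw [add_eq_zero_iff_of_nonneg hO hP, sum_eq_zero_iff_of_nonneg hother,
    sum_eq_zero_iff_of_nonneg hpair] at hzero
  refine ⟨(hy.neighborFinset_subset_of_sum_sdiff_nonpos (by linarith)).antisymm
    (union_subset inter_subset_left inter_subset_left), fun w hw => ?_, fun w hw => ?_⟩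
  · have hpos := zero_lt_one.trans_le (hW (sdiff_subset hw))
    exact (sub_eq_zero.1 ((mul_eq_zero.1 (hzero.1 w hw)).resolve_left hpos.ne')).symm
  · exact (mul_eq_zero.1 (hzero.2 w hw)).imp (fun h => Nat.cast_eq_one.1 (sub_eq_zero.1 h))
      fun h => (sub_eq_zero.1 h).symm

theorem two_lt_degree_of_ssubset (hy : IsPerronVectorAt G u y) (hG : G.IsKConnected 2)
    (hT : G.CliqueFree 3) (hfar : farEdgeFinset G u = {s(a, b)})
    (hrho : (#G.edgeFinset : ℝ) - 2 < G.rho ^ 2) (hW : {a, b} ⊂ Gᶜ.neighborFinset u) :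
    2 < G.degree u := by
  have hm : (6 : ℝ) ≤ #G.edgeFinset := by exact_mod_cast five_lt_card_edgeFinset hG hT hfar hW
  have hdeg := hy.rho_le_degree
  have hrho0 : 0 ≤ G.rho := hy.rho_eq_sum ▸ sum_nonneg fun v _ => hy.nonneg v
  rw [← Nat.cast_lt (α := ℝ), Nat.cast_ofNat]
  nlinarith

theorem neighborFinset_compl_eq_pair (hy : IsPerronVectorAt G u y)
    (hG : G.IsMinimallyKConnected 2) (hT : G.CliqueFree 3)
    (hfar : farEdgeFinset G u = {s(a, b)}) (hrho : (#G.edgeFinset : ℝ) - 2 < G.rho ^ 2)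
    (hN : G.neighborFinset u = commonNeighborFinset G u a ∪ commonNeighborFinset G u b)
    (hone : ∀ w ∈ Gᶜ.neighborFinset u \ {a, b}, y w = 1) : Gᶜ.neighborFinset u = {a, b} := by
  by_contra hne
  have hss := (pair_subset_neighborFinset_compl hfar).ssubset_of_ne (Ne.symm hne)
  obtain ⟨w, hwW, hwab⟩ := exists_of_ssubset hss
  have hw1 := hone w (mem_sdiff.2 ⟨hwW, hwab⟩)
  rw [mem_neighborFinset, compl_adj] at hwW
  have hwu : G.neighborFinset w = G.neighborFinset u := by
    refine hy.neighborFinset_eq_of_apply_eq_one hw1 fun x hx => ?_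
    rw [mem_neighborFinset, adj_iff_mem_commonNeighborFinset_or hwW.2, hfar, mem_singleton] at hx
    refine mem_of_mem_inter_left (hx.resolve_right fun h => hwab ?_)
    rw [mem_insert, mem_singleton, ← Sym2.mem_iff, ← h]
    exact Sym2.mem_mk_left w x
  have hadj (x : V) : G.Adj w x ↔ G.Adj u x := by
    rw [← mem_neighborFinset, hwu, mem_neighborFinset]
  obtain ⟨hab, hua, hub⟩ := adj_of_farEdgeFinset_eq_singleton hfar
  obtain ⟨p, hp⟩ := commonNeighborFinset_nonempty hG.1 hfar hua
  obtain ⟨q, hq⟩ := commonNeighborFinset_nonempty hG.1 hfar hub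
  have hpq := disjoint_iff_ne.1 (disjoint_commonNeighborFinset_of_adj hT hab) p hp q hq
  rw [mem_commonNeighborFinset] at hp hq
  have hdeg := hy.two_lt_degree_of_ssubset hG.1 hT hfar hrho hss
  obtain ⟨v, hv, hvpq⟩ := exists_mem_notMem_of_card_lt_card
    (card_le_two.trans_lt (G.card_neighborFinset_eq_degree u ▸ hdeg) :
      #{p, q} < #(G.neighborFinset u))
  rw [mem_insert, mem_singleton, not_or] at hvpq
  rw [hN, mem_union, mem_commonNeighborFinset, mem_commonNeighborFinset] at hv
  rcases hv with ⟨huv, hav⟩ | ⟨huv, hbv⟩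
  · exact not_adj_of_twin hG hwW.1.symm hadj hab hua hub hp.1 hp.2 hq.1 hq.2 huv hpq hvpq.1 hvpq.2
      hav
  · exact not_adj_of_twin hG hwW.1.symm hadj hab.symm hub hua hq.1 hq.2 hp.1 hp.2 huv hpq.symm
      hvpq.2 hvpq.1 hbv

theorem exists_card_commonNeighborFinset_eq_one (hy : IsPerronVectorAt G u y)
    (hG : G.IsKConnected 2) (hT : G.CliqueFree 3) (hfar : farEdgeFinset G u = {s(a, b)})
    (hrho : (#G.edgeFinset : ℝ) - 2 < G.rho ^ 2)
    (hN : G.neighborFinset u = commonNeighborFinset G u a ∪ commonNeighborFinset G u b)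
    (hW : Gᶜ.neighborFinset u = {a, b})
    (hpair : ∀ w ∈ ({a, b} : Finset V), #(commonNeighborFinset G u w) = 1 ∨ y w = 1) :
    #(commonNeighborFinset G u a) = 1 ∨ #(commonNeighborFinset G u b) = 1 := by
  obtain ⟨hab, hua, hub⟩ := adj_of_farEdgeFinset_eq_singleton hfar
  rcases hpair a (by simp) with ha | hya
  · exact Or.inl ha
  rcases hpair b (by simp) with hb | hyb
  · exact Or.inr hb
  have hsum := hy.rho_sub_one_mul_add hT hfar
  rw [← hN, Finset.sdiff_self, sum_empty, hya, hyb] at hsum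
  have hrho2 : G.rho = 2 := by linarith
  have hm : #G.edgeFinset < 6 := by
    rw [← Nat.cast_lt (α := ℝ), Nat.cast_ofNat]
    rw [hrho2] at hrho
    linarith
  have hdeg := card_edgeFinset_eq_two_mul_degree_add_one hT hfar hW hN
  have hcard := card_union_of_disjoint (disjoint_commonNeighborFinset_of_adj (u := u) hT hab)
  rw [← hN, card_neighborFinset_eq_degree] at hcard
  have hb := card_pos.2 (commonNeighborFinset_nonempty hG hfar hub)
  have ha := card_pos.2 (commonNeighborFinset_nonempty hG hfar hua)
  omega

end IsPerronVectorAt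

theorem exists_iso_subdivideEdge_of_one_le [Nonempty V] (hG : G.IsMinimallyKConnected 2)
    (hT : G.CliqueFree 3) (hodd : Odd #G.edgeFinset) (hrho : 1 < G.rho)
    (h : 1 ≤ (G.rho - 1) * (G.rho ^ 2 - (#G.edgeFinset - 2))) :
    ∃ e ∈ (completeBipartiteGraph (Fin 2) (Fin ((#G.edgeFinset - 1) / 2))).edgeSet,
      Nonempty (G ≃g
        (completeBipartiteGraph (Fin 2) (Fin ((#G.edgeFinset - 1) / 2))).subdivideEdge e) := by
  obtain ⟨u, y, hy⟩ := exists_isPerronVectorAt G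
  have hsq : (#G.edgeFinset : ℝ) - 2 < G.rho ^ 2 :=
    sub_pos.1 (pos_of_mul_pos_right (zero_lt_one.trans_le h) (sub_nonneg.2 hrho.le))
  obtain ⟨a, b, hfar⟩ := exists_farEdgeFinset_eq_singleton hG hT hodd hy hsq
  obtain ⟨hN, hone, hpair⟩ := hy.tight_of_one_le hG.1 hT hfar hrho h
  have hW := hy.neighborFinset_compl_eq_pair hG hT hfar hsq hN hone
  rw [card_edgeFinset_eq_two_mul_degree_add_one hT hfar hW hN, Nat.add_sub_cancel,
    Nat.mul_div_cancel_left _ two_pos]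
  rcases hy.exists_card_commonNeighborFinset_eq_one hG.1 hT hfar hsq hN hW hpair with ha | hb
  · exact exists_iso_subdivideEdge_of_card_commonNeighborFinset_eq_one hT
      (hfar.trans (congrArg _ Sym2.eq_swap)) (hW.trans (pair_comm a b))
      (hN.trans (union_comm _ _)) ha
  · exact exists_iso_subdivideEdge_of_card_commonNeighborFinset_eq_one hT hfar hW hN hb

end OddEdgeCount

section Cubic

theorem sub_one_mul_sq_sub_lt {c r x : ℝ} (hr : 1 ≤ r) (hc : c ≤ r ^ 2) (hx : r < x) :
    (r - 1) * (r ^ 2 - c) < (x - 1) * (x ^ 2 - c) :=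
  mul_lt_mul'' (sub_lt_sub_right hx 1)
    (sub_lt_sub_right (pow_lt_pow_left₀ hx (zero_le_one.trans hr) two_ne_zero) c)
    (sub_nonneg.2 hr) (sub_nonneg.2 hc)

theorem exists_isGreatest_cubic_root {m : ℝ} (hm : 3 < m) :
    ∃ r : ℝ, IsGreatest {x : ℝ | x ^ 3 - x ^ 2 - (m - 2) * x + m - 3 = 0} r ∧ 1 < r ∧
      (r - 1) * (r ^ 2 - (m - 2)) = 1 ∧ ∀ x, r ≤ x → 1 ≤ (x - 1) * (x ^ 2 - (m - 2)) := by
  have hroot (x : ℝ) : x ∈ {x : ℝ | x ^ 3 - x ^ 2 - (m - 2) * x + m - 3 = 0} ↔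
      (x - 1) * (x ^ 2 - (m - 2)) = 1 := by
    rw [Set.mem_ofPred_eq, ← sub_eq_zero (b := (1 : ℝ))]
    ring_nf
  have hsq : √(m - 2) ^ 2 = m - 2 := Real.sq_sqrt (by linarith)
  have hone : 1 < √(m - 2) := Real.lt_sqrt_of_sq_lt (by linarith)
  have hcont : ContinuousOn (fun x : ℝ => (x - 1) * (x ^ 2 - (m - 2))) (Set.Icc √(m - 2) m) := by
    fun_prop
  obtain ⟨r, ⟨hlow, -⟩, hr⟩ := intermediate_value_Icc
    (Real.sqrt_le_iff.2 ⟨by linarith, by nlinarith⟩) hcont (show (1 : ℝ) ∈ Set.Icc _ _ from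
      ⟨by simp [hsq], one_le_mul_of_one_le_of_one_le (by linarith) (by nlinarith)⟩)
  have hlt {x : ℝ} (hx : r < x) : 1 < (x - 1) * (x ^ 2 - (m - 2)) :=
    hr.symm.trans_lt <| sub_one_mul_sq_sub_lt (hone.le.trans hlow)
      (hsq ▸ pow_le_pow_left₀ (Real.sqrt_nonneg _) hlow 2) hx
  refine ⟨r, ⟨(hroot r).2 hr, fun x hx => ?_⟩, hone.trans_le hlow, hr, fun x hx => ?_⟩
  · by_contra! hrx
    exact (hlt hrx).ne' ((hroot x).1 hx)
  · rcases hx.eq_or_lt with rfl | hx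
    exacts [hr.ge, (hlt hx).le]

end Cubic

section MainTheorem

variable {V : Type*} [Fintype V] [DecidableEq V] {G : SimpleGraph V} [DecidableRel G.Adj] {m : ℕ}

theorem rho_eq_sqrt_iff (hG : G.IsMinimallyKConnected 2) (hm : #G.edgeFinset = m) (hm3 : m ≠ 3) :
    G.rho = √m ↔ Even m ∧ Nonempty (G ≃g completeBipartiteGraph (Fin 2) (Fin (m / 2))) := by
  classical
  have hV := lt_card_of_isKConnected two_pos hG.1
  have : Nonempty V := Fintype.card_pos_iff.1 (by omega)
  constructor
  · rw [← hm] at hm3 ⊢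
    intro h
    obtain ⟨n, ⟨φ⟩⟩ := exists_iso_completeBipartiteGraph_two_of_rho_eq_sqrt hG
      (cliqueFree_three_of_isMinimallyKConnected hG hm3) h
    rw [card_edgeFinset_of_iso_completeBipartiteGraph φ, Fintype.card_fin, Fintype.card_fin,
      Nat.mul_div_cancel_left _ two_pos]
    exact ⟨even_two_mul n, ⟨φ⟩⟩
  · rintro ⟨heven, ⟨φ⟩⟩
    have hle := card_le_card_edgeFinset_of_isKConnected le_rfl hG.1
    have : Nonempty (Fin (m / 2)) := Fin.pos_iff_nonempty.1 (by omega)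
    rw [rho_eq_of_iso φ, rho_completeBipartiteGraph, ← Nat.cast_mul, Fintype.card_fin,
      Fintype.card_fin, Nat.two_mul_div_two_of_even heven]

theorem rho_eq_of_iso_subdivideEdge (hodd : Odd m) {r : ℝ} (hr : 1 < r)
    (h : (r - 1) * (r ^ 2 - (m - 2)) = 1) {e : Sym2 (Fin 2 ⊕ Fin ((m - 1) / 2))}
    (he : e ∈ (completeBipartiteGraph (Fin 2) (Fin ((m - 1) / 2))).edgeSet)
    (φ : G ≃g (completeBipartiteGraph (Fin 2) (Fin ((m - 1) / 2))).subdivideEdge e) :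
    G.rho = r := by
  classical
  have hm : 2 * ((m - 1) / 2) + 1 = m := by
    obtain ⟨k, rfl⟩ := hodd
    omega
  have hm' : (2 * ((m - 1) / 2 : ℕ) + 1 : ℝ) = m := by exact_mod_cast hm
  rw [rho_eq_of_iso φ]
  refine rho_subdivideEdge_completeBipartiteGraph_two he hr ?_
  rwa [show (2 * ((m - 1) / 2 : ℕ) - 1 : ℝ) = m - 2 by linarith]

theorem exists_isGreatest_rho_le_of_odd (hG : G.IsMinimallyKConnected 2) (hm : #G.edgeFinset = m)
    (hm3 : m ≠ 3) (hodd : Odd m) :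
    ∃ r : ℝ, IsGreatest {x : ℝ | x ^ 3 - x ^ 2 - ((m : ℝ) - 2) * x + (m : ℝ) - 3 = 0} r ∧
      G.rho ≤ r ∧
      (G.rho = r ↔
        ∃ e ∈ (completeBipartiteGraph (Fin 2) (Fin ((m - 1) / 2))).edgeSet,
          Nonempty (G ≃g
            (completeBipartiteGraph (Fin 2) (Fin ((m - 1) / 2))).subdivideEdge e)) := by
  have hV := lt_card_of_isKConnected two_pos hG.1
  have : Nonempty V := Fintype.card_pos_iff.1 (by omega)
  have hle := card_le_card_edgeFinset_of_isKConnected le_rfl hG.1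
  obtain ⟨r, hr, hr1, hreq, hge⟩ := exists_isGreatest_cubic_root (m := m)
    (by exact_mod_cast (show 3 < m by omega))
  have hT := cliqueFree_three_of_isMinimallyKConnected hG (hm ▸ hm3)
  have hiso (h : r ≤ G.rho) : ∃ e ∈ (completeBipartiteGraph (Fin 2) (Fin ((m - 1) / 2))).edgeSet,
      Nonempty (G ≃g (completeBipartiteGraph (Fin 2) (Fin ((m - 1) / 2))).subdivideEdge e) := by
    subst hm
    exact exists_iso_subdivideEdge_of_one_le hG hT hodd (hr1.trans_le h) (hge _ h)
  refine ⟨r, hr, ?_, fun h => hiso h.ge, fun ⟨e, he, ⟨φ⟩⟩ =>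
    rho_eq_of_iso_subdivideEdge hodd hr1 hreq he φ⟩
  by_contra! hlt
  obtain ⟨e, he, ⟨φ⟩⟩ := hiso hlt.le
  exact hlt.ne' (rho_eq_of_iso_subdivideEdge hodd hr1 hreq he φ)

theorem theorem1p1_general (hG : G.IsMinimallyKConnected 2) (hm : #G.edgeFinset = m)
    (hm3 : m ≠ 3) :
    (G.rho ≤ √m ∧
      (G.rho = √m ↔ Even m ∧ Nonempty (G ≃g completeBipartiteGraph (Fin 2) (Fin (m / 2))))) ∧
    (Odd m →
      ∃ r : ℝ, IsGreatest {x : ℝ | x ^ 3 - x ^ 2 - ((m : ℝ) - 2) * x + (m : ℝ) - 3 = 0} r ∧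
        G.rho ≤ r ∧
        (G.rho = r ↔
          ∃ e ∈ (completeBipartiteGraph (Fin 2) (Fin ((m - 1) / 2))).edgeSet,
            Nonempty (G ≃g
              (completeBipartiteGraph (Fin 2) (Fin ((m - 1) / 2))).subdivideEdge e))) := by
  have hV := lt_card_of_isKConnected two_pos hG.1
  have : Nonempty V := Fintype.card_pos_iff.1 (by omega)
  have hT := cliqueFree_three_of_isMinimallyKConnected hG (hm ▸ hm3)
  exact ⟨⟨hm ▸ rho_le_sqrt_card_edgeFinset hT, rho_eq_sqrt_iff hG hm hm3⟩,
    exists_isGreatest_rho_le_of_odd hG hm hm3⟩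

end MainTheorem

end

theorem theorem1p1 {V : Type*} [Fintype V] [DecidableEq V] (G : SimpleGraph V)
    [DecidableRel G.Adj] (m : ℕ) (hG : G.IsMinimallyKConnected 2) (hm : G.edgeFinset.card = m) :
    (Even m →
      G.rho ≤ √(m : ℝ) ∧
      (G.rho = √(m : ℝ) ↔ Nonempty (G ≃g completeBipartiteGraph (Fin 2) (Fin (m / 2))))) ∧
    (Odd m → 9 ≤ m →
      ∃ r : ℝ, IsGreatest {x : ℝ | x ^ 3 - x ^ 2 - ((m : ℝ) - 2) * x + (m : ℝ) - 3 = 0} r ∧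
        G.rho ≤ r ∧
        (G.rho = r ↔
          ∃ e ∈ (completeBipartiteGraph (Fin 2) (Fin ((m - 1) / 2))).edgeSet,
            Nonempty (G ≃g
              (completeBipartiteGraph (Fin 2) (Fin ((m - 1) / 2))).subdivideEdge e))) := by
  refine ⟨fun heven => ?_, fun hodd h9 => (theorem1p1_general hG hm (by omega)).2 hodd⟩
  have h := (theorem1p1_general hG hm (by rintro rfl; revert heven; decide)).1
  exact ⟨h.1, h.2.trans (and_iff_right heven)⟩
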